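/- Let $(Z,d)$ be a complete separable metric space with its Borel $\sigma$-algebra, let $X_1,X_2\subseteq Z$ be Borel sets and let $\mu_1,\mu_2$ be (arbitrary, possibly infinite) measures on the Borel sets of $Z$. For $X\subseteq Z$ and a Borel measure $\mu$ on $Z$, let the measure Dowker bifiltration $\mathcal{MD}(X,\mu)$, indexed by the poset $T'=\,]0,\infty[^{op}\times[0,\infty[$, be the filtered simplicial complex in which a finite non-empty $\sigma\subseteq X$ is a simplex of $\mathcal{MD}(X,\mu)_{m,r}$ if and only if $$\mu\bigl(\{z\in Z: d(x,z)\le 2r \text{ for all } x\in\sigma\}\bigr)\ge m .$$ Regard it, via geometric realization (with the weak topology), as a functor from $T'$ to the category $\mathbf{Top}$ of compactly generated weakly Hausdorff spaces. Then $$d_{HI}\bigl(\mathcal{MD}(X_1,\mu_1),\mathcal{MD}(X_2,\mu_2)\bigr)\;\le\;\max\bigl\{d_H(X_1,X_2),\,d_{Pr}(\mu_1,\mu_2)\bigr\},$$ where all three distances take values in $[0,\infty]$ (with $\inf\emptyset=\infty$) and are defined as follows. - $d_H$ is the Hausdorff distance in $Z$. - $d_{Pr}(\mu,\eta)$ is the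 infimum of all $\varepsilon>0$ such that $\mu(A)\le\eta(A^\varepsilon)+\varepsilon$ and $\eta(A)\le\mu(A^\varepsilon)+\varepsilon$ for all closed $A\subseteq Z$, where $A^\varepsilon=\{z\in Z:\exists a\in A,\ d(a,z)\le\varepsilon\}$ (the Prokhorov distance). - Two functors $F,G\colon T'\to\mathbf{Top}$ are weakly equivalent, $F\simeq G$, if they are connected by a finite zig-zag of natural transformations all of whose components are homotopy equivalences. They are $\delta$-interleaved if $F$ and $G$ are the restrictions to $T'\times\{0\}$ and $T'\times\{1\}$ of a functor defined on the thin category with objects $T'\times\{0,1\}$ that has a morphism $((m,r),i)\to((m',r'),j)$ if and only if either $i=j$, $m'\le m$ and $r\le r'$, or $i\ne j$, $m'\le m-\delta$ and $r+\delta\le r'$. The homotopy interleaving distance $d_{HI}(F,G)$ is the infimum of all $\delta>0$ for which there are $F'\simeq F$ and $G'\simeq G$ that are $\delta$-interleaved. -/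

import Mathlib

open CategoryTheory MeasureTheory
open scoped ENNReal NNReal

universe u v

noncomputable section

/-! ### Compactly generated weakly Hausdorff spaces -/

/-- The property of a topological space of being compactly generated and weakly Hausdorff: a set is
closed as soon as its preimage under every continuous map from a compact Hausdorff space is closed,
and every such map has closed image. -/
def isCGWH : ObjectProperty TopCat.{u} := fun X =>
  CompactlyGeneratedSpace X ∧ ∀ (S : CompHaus.{u}) (f : C(S, X)), IsClosed (Set.range f)

/-- The category of compactly generated weakly Hausdorff spaces and continuous maps. -/
abbrev CGWH : Type (u + 1) := (isCGWH.{u}).FullSubcategory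

/-! ### Geometric realization of abstract simplicial complexes

An abstract simplicial complex with vertices in `V` is a `PreAbstractSimplicialComplex V`: a set of
finite nonempty subsets of `V` closed under passing to nonempty subsets (an element of `V` is a
vertex only if its singleton is a face). These are ordered by inclusion. -/

namespace PreAbstractSimplicialComplex

variable {V : Type u}

/-- The points of the geometric realization `|K|`: formal convex combinations of vertices whose
support is a face of `K`. -/
@[ext]
structure Realization (K : PreAbstractSimplicialComplex V) : Type u where
  /-- the barycentric coordinates -/
  coords : V →₀ ℝ
  nonneg : ∀ v, 0 ≤ coords v
  sum_eq_one : (coords.sum fun _ a => a) = 1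
  support_mem : coords.support ∈ K.faces

namespace Realization

lemma sum_embDomain_eq_one {σ : Finset V} (x : stdSimplex ℝ σ) :
    ((Finsupp.equivFunOnFinite.symm x.1).embDomain
      (Function.Embedding.subtype (· ∈ σ))).sum (fun _ a => a) = 1 := by
  rw [Finsupp.sum_embDomain, Finsupp.sum_fintype _ _ (fun _ => rfl)]
  simpa using x.2.2

/-- The characteristic map of the closed simplex spanned by the face `σ` of `K`: barycentric
coordinates on `σ` are extended by zero. -/
def ofFace (K : PreAbstractSimplicialComplex V) (σ : K.faces)
    (x : stdSimplex ℝ (σ : Finset V)) : K.Realization where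
  coords := (Finsupp.equivFunOnFinite.symm x.1).embDomain (Function.Embedding.subtype _)
  nonneg v := by
    by_cases hv : v ∈ (σ : Finset V)
    · exact (x.2.1 ⟨v, hv⟩).trans_eq (Finsupp.embDomain_apply_self
        (Function.Embedding.subtype (· ∈ (σ : Finset V)))
        (Finsupp.equivFunOnFinite.symm x.1) ⟨v, hv⟩).symm
    · rw [Finsupp.embDomain_of_notMem_range]
      simpa using hv
  sum_eq_one := sum_embDomain_eq_one x
  support_mem := by
    refine (K.isRelLowerSet_faces σ.2).2 ?_ ?_
    · intro v hv
      rw [Finsupp.support_embDomain, Finset.mem_map] at hv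
      obtain ⟨w, -, rfl⟩ := hv
      exact w.2
    · rw [Finset.nonempty_iff_ne_empty]
      intro h
      have hsum := sum_embDomain_eq_one x
      rw [Finsupp.sum, h, Finset.sum_empty] at hsum
      exact zero_ne_one hsum

/-- The weak (coherent) topology on `|K|`: a set is closed if and only if its intersection with
every closed simplex is closed, where the closed simplices carry the Euclidean topology. -/
instance (K : PreAbstractSimplicialComplex V) : TopologicalSpace K.Realization :=
  ⨆ σ : K.faces, TopologicalSpace.coinduced (ofFace K σ) inferInstance

lemma continuous_ofFace (K : PreAbstractSimplicialComplex V) (σ : K.faces) :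
    Continuous (ofFace K σ) :=
  continuous_iff_coinduced_le.2
    (le_iSup (fun σ : K.faces => TopologicalSpace.coinduced (ofFace K σ) inferInstance) σ)

lemma continuous_iff {K : PreAbstractSimplicialComplex V} {Y : Type*} [TopologicalSpace Y]
    (f : K.Realization → Y) : Continuous f ↔ ∀ σ, Continuous (f ∘ ofFace K σ) := by
  rw [continuous_iSup_dom]
  simp only [continuous_coinduced_dom]

lemma continuous_coord (K : PreAbstractSimplicialComplex V) (v : V) :
    Continuous fun t : K.Realization => t.coords v := by
  rw [continuous_iff]
  intro σ
  by_cases hv : v ∈ (σ : Finset V)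
  · have : ((fun t : K.Realization => t.coords v) ∘ ofFace K σ) = fun x => x.1 ⟨v, hv⟩ := by
      funext x
      exact Finsupp.embDomain_apply_self (Function.Embedding.subtype (· ∈ (σ : Finset V)))
          (Finsupp.equivFunOnFinite.symm x.1) ⟨v, hv⟩
    rw [this]
    exact (continuous_apply _).comp continuous_subtype_val
  · have : ((fun t : K.Realization => t.coords v) ∘ ofFace K σ) = fun _ => 0 := by
      funext x
      exact Finsupp.embDomain_of_notMem_range _ _ _ (by simpa using hv)
    rw [this]
    exact continuous_const

instance (K : PreAbstractSimplicialComplex V) : T2Space K.Realization :=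
  T2Space.of_injective_continuous (f := fun (t : K.Realization) (v : V) => t.coords v)
    (fun _ _ h => Realization.ext (DFunLike.coe_injective h))
    (continuous_pi fun v => continuous_coord K v)

lemma isCGWH_realization (K : PreAbstractSimplicialComplex V) :
    isCGWH (TopCat.of K.Realization) := by
  refine ⟨?_, fun S f => (isCompact_range f.continuous).isClosed⟩
  refine uCompactlyGeneratedSpace_of_continuous_maps (X := K.Realization) fun f hf => ?_
  rw [continuous_iff]
  intro σ
  exact hf (CompHaus.of (stdSimplex ℝ (σ : Finset V))) ⟨ofFace K σ, continuous_ofFace K σ⟩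

/-- The inclusion `|K| → |L|` induced by an inclusion of complexes `K ≤ L`. -/
def inclusion {K L : PreAbstractSimplicialComplex V} (h : K ≤ L) : C(K.Realization, L.Realization)
    where
  toFun t := ⟨t.coords, t.nonneg, t.sum_eq_one, h t.support_mem⟩
  continuous_toFun := by
    rw [continuous_iff]
    intro σ
    exact continuous_ofFace L ⟨σ.1, h σ.2⟩

end Realization

/-- Geometric realization as a functor from the poset of complexes on `V`, ordered by inclusion. -/
def realization (V : Type u) : PreAbstractSimplicialComplex V ⥤ CGWH.{u} where
  obj K := ⟨TopCat.of K.Realization, Realization.isCGWH_realization K⟩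
  map f := ObjectProperty.homMk (TopCat.ofHom (Realization.inclusion (leOfHom f)))

end PreAbstractSimplicialComplex

/-! ### Bifiltrations and the homotopy interleaving distance -/

/-- The poset `]0,∞[ᵒᵖ × [0,∞[`. -/
@[ext]
structure BiIndex where
  /-- the mass parameter -/
  m : ℝ
  /-- the scale parameter -/
  r : ℝ
  m_pos : 0 < m
  r_nonneg : 0 ≤ r

instance : PartialOrder BiIndex where
  le s t := t.m ≤ s.m ∧ s.r ≤ t.r
  le_refl _ := ⟨le_rfl, le_rfl⟩
  le_trans _ _ _ h h' := ⟨h'.1.trans h.1, h.2.trans h'.2⟩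
  le_antisymm _ _ h h' := BiIndex.ext (le_antisymm h'.1 h.1) (le_antisymm h.2 h'.2)

/-- Two functors are objectwise equivalent if there is a natural transformation from the first to
the second all of whose components are homotopy equivalences. -/
def ObjectwiseEquiv (F G : BiIndex ⥤ CGWH.{u}) : Prop :=
  ∃ η : F ⟶ G, ∀ t, ∃ e : ContinuousMap.HomotopyEquiv (F.obj t).obj (G.obj t).obj,
    e.toFun = (η.app t).hom.hom

/-- Two functors are weakly equivalent if they are connected by a finite zig-zag of objectwise
equivalences. -/
def WeaklyEquiv : (BiIndex ⥤ CGWH.{u}) → (BiIndex ⥤ CGWH.{u}) → Prop :=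
  Relation.EqvGen ObjectwiseEquiv

/-- The objects of the interleaving category for the forward shift `(m, r) ↦ (m - δ, r + δ)`:
two copies, labelled by `side`, of the index poset. -/
@[ext]
structure InterleavingIndex (δ : ℝ≥0) where
  /-- the underlying bidegree -/
  idx : BiIndex
  /-- the copy -/
  side : Fin 2

/-- There is a (unique) morphism `(s, i) ⟶ (t, j)` if and only if `i = j` and `s ≤ t`, or `i ≠ j`
and `t` is at least the shift of `s` by `δ`. (The mass coordinate of the shift need not be
positive; the comparison takes place in `ℝᵒᵖ × [0,∞[`.) -/
instance (δ : ℝ≥0) : Preorder (InterleavingIndex δ) where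
  le p q := (p.side = q.side ∧ p.idx ≤ q.idx) ∨
    (p.side ≠ q.side ∧ q.idx.m ≤ p.idx.m - δ ∧ p.idx.r + δ ≤ q.idx.r)
  le_refl _ := Or.inl ⟨rfl, le_rfl⟩
  le_trans p q s := by
    rintro (⟨h, hm, hr⟩ | ⟨h, hm, hr⟩) (⟨h', hm', hr'⟩ | ⟨h', hm', hr'⟩)
    · exact Or.inl ⟨h.trans h', hm'.trans hm, hr.trans hr'⟩
    · exact Or.inr ⟨h ▸ h', by linarith, by linarith⟩
    · exact Or.inr ⟨h' ▸ h, by linarith, by linarith⟩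
    · have hd : (0 : ℝ) ≤ δ := δ.2
      refine Or.inl ⟨by lia, ?_, ?_⟩ <;> linarith

/-- The inclusion of the index poset as the `i`-th copy in the interleaving category. -/
def interleavingInclusion (δ : ℝ≥0) (i : Fin 2) : BiIndex ⥤ InterleavingIndex δ :=
  Monotone.functor (f := fun t => ⟨t, i⟩) fun _ _ h => Or.inl ⟨rfl, h⟩

/-- `F` and `G` are `δ`-interleaved: they are the two restrictions of a functor on the interleaving
category. -/
def Interleaved {C : Type*} [Category C] (δ : ℝ≥0) (F G : BiIndex ⥤ C) : Prop :=
  ∃ H : InterleavingIndex δ ⥤ C,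
    F = interleavingInclusion δ 0 ⋙ H ∧ G = interleavingInclusion δ 1 ⋙ H

/-- The homotopy interleaving distance (with `inf ∅ = ∞`). -/
def homotopyInterleavingDist (F G : BiIndex ⥤ CGWH.{u}) : ℝ≥0∞ :=
  sInf {ε | ∃ δ : ℝ≥0, 0 < δ ∧ ε = δ ∧
    ∃ F' G' : BiIndex ⥤ CGWH.{u}, WeaklyEquiv F' F ∧ WeaklyEquiv G' G ∧ Interleaved δ F' G'}

/-! ### The measure Dowker bifiltration -/

/-- The measure Dowker bifiltration of a set `X`, a measure space `(Y, μ)` and a function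
`Λ : X × Y → ℝ`: a finite nonempty `σ ⊆ X` is a simplex at `(m, r)` if and only if
`μ {y | Λ(x, y) ≤ 2r for all x ∈ σ} ≥ m`. -/
def measureDowkerOf {X : Type u} {Y : Type v} [MeasurableSpace Y] (μ : Measure Y)
    (Λ : X → Y → ℝ) : BiIndex ⥤ PreAbstractSimplicialComplex X :=
  Monotone.functor
    (f := fun t =>
      { faces := {σ | σ.Nonempty ∧ ENNReal.ofReal t.m ≤ μ {y | ∀ x ∈ σ, Λ x y ≤ 2 * t.r}}
        isRelLowerSet_faces := fun _ hσ => ⟨hσ.1, fun _ hτσ hτ =>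
          ⟨hτ, hσ.2.trans (measure_mono fun _ hy x hx => hy x (hτσ hx))⟩⟩ })
    fun _ _ hst _ hσ => ⟨hσ.1, (ENNReal.ofReal_le_ofReal hst.1).trans
      (hσ.2.trans (measure_mono fun _ hy x hx =>
        (hy x hx).trans (mul_le_mul_of_nonneg_left hst.2 zero_le_two)))⟩

/-- The measure Dowker bifiltration `MD(X, μ)` of a subset `X` of a metric space `Z` and a measure
`μ` on `Z`, with respect to the distance function on `X × Z`. -/
def measureDowker {Z : Type u} [MetricSpace Z] [MeasurableSpace Z] (X : Set Z) (μ : Measure Z) :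
    BiIndex ⥤ PreAbstractSimplicialComplex X :=
  measureDowkerOf μ fun (x : X) (z : Z) => dist (x : Z) z

/-- The bifiltered space `|MD(X, μ)|`. -/
def measureDowkerSpace {Z : Type u} [MetricSpace Z] [MeasurableSpace Z] (X : Set Z)
    (μ : Measure Z) : BiIndex ⥤ CGWH.{u} :=
  measureDowker X μ ⋙ PreAbstractSimplicialComplex.realization X

end

noncomputable section

namespace PreAbstractSimplicialComplex

/-! ### Maps into geometric realizations -/

namespace Realization

variable {V : Type u}

/-! For ε above both distances, let C be the set of pairs in X₁ × X₂ at distance below ε. Since ε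
exceeds the Hausdorff distance, both projections of C are surjective. Pulling the two bifiltrations
back along them puts both on the vertex set C. This only replaces each vertex by its fibre, spanning
simplices freely inside fibres, so the weak type is unchanged (`objectwiseEquiv_comap`): a section
of the projection is a homotopy inverse, by a straight line homotopy (`homotopic_of_contiguous`). On
C no maps need to be chosen: by the triangle inequality and the Prokhorov bound each pullback is a
subcomplex of the ε-shift of the other (`comap_measureDowker_le`). Inclusions commute strictly, so
the pullbacks are ε-interleaved. -/

lemma apply_eq_zero_of_support_subset {x : V →₀ ℝ} {σ : Finset V} (h : x.support ⊆ σ) {v : V}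
    (hv : v ∉ σ) : x v = 0 :=
  Finsupp.notMem_support_iff.1 fun hv' => hv (h hv')

lemma support_ofFace_subset (K : PreAbstractSimplicialComplex V) (σ : K.faces)
    (x : stdSimplex ℝ (σ : Finset V)) : (ofFace K σ x).coords.support ⊆ σ := by
  intro v hv
  have hv' : v ∈ ((Finsupp.equivFunOnFinite.symm x.1).embDomain
      (Function.Embedding.subtype (· ∈ (σ : Finset V)))).support := hv
  rw [Finsupp.support_embDomain, Finset.mem_map] at hv'
  obtain ⟨w, -, rfl⟩ := hv'
  exact w.2

lemma ofFace_coords_apply (K : PreAbstractSimplicialComplex V) (σ : K.faces)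
    (x : stdSimplex ℝ (σ : Finset V)) (v : (σ : Finset V)) : (ofFace K σ x).coords v = x.1 v :=
  Finsupp.embDomain_apply_self (Function.Embedding.subtype (· ∈ (σ : Finset V)))
    (Finsupp.equivFunOnFinite.symm x.1) v

lemma support_nonempty {x : V →₀ ℝ} (h : (x.sum fun _ a => a) = 1) : x.support.Nonempty := by
  rw [Finset.nonempty_iff_ne_empty]
  intro h'
  rw [Finsupp.sum, h', Finset.sum_empty] at h
  exact zero_ne_one h

/-- A map into a geometric realization whose image lies in one closed simplex is continuous as soon
as its barycentric coordinates are. -/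
lemma continuous_of_support_subset {K : PreAbstractSimplicialComplex V} {T : Type*}
    [TopologicalSpace T] {g : T → K.Realization} {τ : Finset V} (hτ : τ ∈ K.faces)
    (hs : ∀ t, (g t).coords.support ⊆ τ) (hg : ∀ v, Continuous fun t => (g t).coords v) :
    Continuous g := by
  -- The map factors through the closed simplex τ, whose topology is that of coordinatewise
  -- convergence.
  let x : T → stdSimplex ℝ τ := fun t => ⟨fun v => (g t).coords v, fun v => (g t).nonneg v, by
    rw [Finset.sum_coe_sort τ (fun v => (g t).coords v), ← (g t).sum_eq_one]
    exact (Finsupp.sum_of_support_subset (g t).coords (hs t) (fun _ a => a) fun _ _ => rfl).symm⟩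
  have hx : Continuous x := by
    rw [continuous_induced_rng]
    exact continuous_pi fun v => hg v
  have hgx : g = ofFace K ⟨τ, hτ⟩ ∘ x := by
    funext t
    refine Realization.ext (Finsupp.ext fun v => ?_)
    by_cases hv : v ∈ τ
    · exact (ofFace_coords_apply K ⟨τ, hτ⟩ (x t) ⟨v, hv⟩).symm
    · rw [apply_eq_zero_of_support_subset (hs t) hv]
      exact (apply_eq_zero_of_support_subset (support_ofFace_subset K ⟨τ, hτ⟩ (x t)) hv).symm
  rw [hgx]
  exact (continuous_ofFace K ⟨τ, hτ⟩).comp hx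

/-! ### Straight line homotopies -/

/-- The point dividing the segment from `p` to `q` in the ratio `s : 1 - s`, if `p` and `q` lie in a
common simplex. -/
def segment {K : PreAbstractSimplicialComplex V} (p q : K.Realization)
    (h : ∃ τ ∈ K.faces, p.coords.support ⊆ τ ∧ q.coords.support ⊆ τ) (s : unitInterval) :
    K.Realization where
  coords := (1 - (s : ℝ)) • p.coords + (s : ℝ) • q.coords
  nonneg v := by
    have h₁ : 0 ≤ 1 - (s : ℝ) := sub_nonneg.2 s.2.2
    exact add_nonneg (mul_nonneg h₁ (p.nonneg v)) (mul_nonneg s.2.1 (q.nonneg v))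
  sum_eq_one := by
    rw [Finsupp.sum_add_index' (fun _ => rfl) (fun _ _ _ => rfl),
      Finsupp.sum_smul_index' (fun _ => rfl), Finsupp.sum_smul_index' (fun _ => rfl),
      ← Finsupp.smul_sum, ← Finsupp.smul_sum, p.sum_eq_one, q.sum_eq_one]
    simp
  support_mem := by
    classical
    obtain ⟨τ, hτ, hp, hq⟩ := h
    refine (K.isRelLowerSet_faces hτ).2 ?_ (support_nonempty ?_)
    · exact Finsupp.support_add.trans (Finset.union_subset (Finsupp.support_smul.trans hp)
        (Finsupp.support_smul.trans hq))
    · rw [Finsupp.sum_add_index' (fun _ => rfl) (fun _ _ _ => rfl),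
        Finsupp.sum_smul_index' (fun _ => rfl), Finsupp.sum_smul_index' (fun _ => rfl),
        ← Finsupp.smul_sum, ← Finsupp.smul_sum, p.sum_eq_one, q.sum_eq_one]
      simp

lemma segment_coords_apply {K : PreAbstractSimplicialComplex V} (p q : K.Realization)
    (h : ∃ τ ∈ K.faces, p.coords.support ⊆ τ ∧ q.coords.support ⊆ τ) (s : unitInterval) (v : V) :
    (segment p q h s).coords v = (1 - (s : ℝ)) * p.coords v + s * q.coords v :=
  rfl

lemma segment_zero {K : PreAbstractSimplicialComplex V} (p q : K.Realization)
    (h : ∃ τ ∈ K.faces, p.coords.support ⊆ τ ∧ q.coords.support ⊆ τ) : segment p q h 0 = p :=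
  Realization.ext (Finsupp.ext fun v => by simp [segment_coords_apply])

lemma segment_one {K : PreAbstractSimplicialComplex V} (p q : K.Realization)
    (h : ∃ τ ∈ K.faces, p.coords.support ⊆ τ ∧ q.coords.support ⊆ τ) : segment p q h 1 = q :=
  Realization.ext (Finsupp.ext fun v => by simp [segment_coords_apply])

lemma support_segment_subset {K : PreAbstractSimplicialComplex V} (p q : K.Realization)
    (h : ∃ τ ∈ K.faces, p.coords.support ⊆ τ ∧ q.coords.support ⊆ τ) (s : unitInterval)
    {τ : Finset V} (hp : p.coords.support ⊆ τ) (hq : q.coords.support ⊆ τ) :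
    (segment p q h s).coords.support ⊆ τ := by
  intro v hv
  by_contra hv'
  refine Finsupp.mem_support_iff.1 hv ?_
  rw [segment_coords_apply, apply_eq_zero_of_support_subset hp hv',
    apply_eq_zero_of_support_subset hq hv', mul_zero, mul_zero, add_zero]

/-- Two maps between geometric realizations which carry every closed simplex into a common closed
simplex are homotopic. -/
lemma homotopic_of_contiguous {W : Type u} {K : PreAbstractSimplicialComplex V}
    {L : PreAbstractSimplicialComplex W} (f g : C(K.Realization, L.Realization))
    (h : ∀ σ ∈ K.faces, ∃ τ ∈ L.faces, ∀ t : K.Realization, t.coords.support ⊆ σ →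
      (f t).coords.support ⊆ τ ∧ (g t).coords.support ⊆ τ) : f.Homotopic g := by
  have hfg (t : K.Realization) :
      ∃ τ ∈ L.faces, (f t).coords.support ⊆ τ ∧ (g t).coords.support ⊆ τ := by
    obtain ⟨τ, hτ, ht⟩ := h _ t.support_mem
    exact ⟨τ, hτ, ht t subset_rfl⟩
  have hseg (t : K.Realization) : Continuous (segment (f t) (g t) (hfg t)) := by
    obtain ⟨τ, hτ, hf, hg⟩ := hfg t
    refine continuous_of_support_subset hτ
      (fun s => support_segment_subset _ _ _ s hf hg) fun v => ?_
    simp only [segment_coords_apply]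
    fun_prop
  -- The homotopy is curried because the weak topology tests continuity on simplices only for maps
  -- out of |K|, not out of I × |K|. Local compactness of the interval allows uncurrying afterwards.
  obtain ⟨H, hHs⟩ : ∃ H : K.Realization → C(unitInterval, L.Realization),
      ∀ t s, H t s = segment (f t) (g t) (hfg t) s := ⟨fun t => ⟨_, hseg t⟩, fun _ _ => rfl⟩
  have hH : Continuous H := by
    rw [continuous_iff]
    intro σ
    refine ContinuousMap.continuous_of_continuous_uncurry _ ?_
    obtain ⟨τ, hτ, ht⟩ := h _ σ.2
    refine Continuous.congr (f := fun p : stdSimplex ℝ (σ : Finset V) × unitInterval =>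
      segment (f (ofFace K σ p.1)) (g (ofFace K σ p.1)) (hfg _) p.2) ?_ fun p => (hHs _ _).symm
    refine continuous_of_support_subset hτ (fun p => ?_) fun w => ?_
    · obtain ⟨hf, hg⟩ := ht _ (support_ofFace_subset K σ p.1)
      exact support_segment_subset _ _ (hfg _) p.2 hf hg
    · have hf : Continuous fun p : stdSimplex ℝ (σ : Finset V) × unitInterval =>
          (f (ofFace K σ p.1)).coords w :=
        (continuous_coord L w).comp
          (f.continuous.comp ((continuous_ofFace K σ).comp continuous_fst))
      have hg : Continuous fun p : stdSimplex ℝ (σ : Finset V) × unitInterval =>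
          (g (ofFace K σ p.1)).coords w :=
        (continuous_coord L w).comp
          (g.continuous.comp ((continuous_ofFace K σ).comp continuous_fst))
      have hs : Continuous fun p : stdSimplex ℝ (σ : Finset V) × unitInterval => (p.2 : ℝ) :=
        continuous_subtype_val.comp continuous_snd
      exact ((continuous_const.sub hs).mul hf).add (hs.mul hg)
  have hH' : Continuous fun p : unitInterval × K.Realization => H p.2 p.1 :=
    (ContinuousMap.continuous_uncurry_of_continuous ⟨H, hH⟩).comp continuous_swap
  refine ⟨⟨⟨fun p => H p.2 p.1, hH'⟩, fun t => ?_, fun t => ?_⟩⟩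
  · exact (hHs t 0).trans (segment_zero _ _ _)
  · exact (hHs t 1).trans (segment_one _ _ _)

/-! ### Simplicial maps -/

lemma mapDomain_nonneg {W : Type*} (f : V → W) {x : V →₀ ℝ} (hx : ∀ v, 0 ≤ x v) (w : W) :
    0 ≤ x.mapDomain f w := by
  classical
  rw [Finsupp.mapDomain, Finsupp.sum, Finsupp.finsetSum_apply]
  refine Finset.sum_nonneg fun v _ => ?_
  rw [Finsupp.single_apply]
  split_ifs
  exacts [hx v, le_rfl]

lemma sum_mapDomain_eq_one {W : Type*} (f : V → W) {x : V →₀ ℝ}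
    (hx : (x.sum fun _ a => a) = 1) : ((x.mapDomain f).sum fun _ a => a) = 1 := by
  rw [Finsupp.sum_mapDomain_index (fun _ => rfl) (fun _ _ _ => rfl), hx]

open Classical in
/-- The continuous map of geometric realizations induced by a simplicial map. -/
def map {W : Type u} {K : PreAbstractSimplicialComplex V} {L : PreAbstractSimplicialComplex W}
    (f : V → W) (hf : ∀ σ ∈ K.faces, σ.image f ∈ L.faces) : C(K.Realization, L.Realization) where
  toFun t :=
    { coords := t.coords.mapDomain f
      nonneg := mapDomain_nonneg f t.nonneg
      sum_eq_one := sum_mapDomain_eq_one f t.sum_eq_one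
      support_mem := (L.isRelLowerSet_faces (hf _ t.support_mem)).2 Finsupp.mapDomain_support
        (support_nonempty (sum_mapDomain_eq_one f t.sum_eq_one)) }
  continuous_toFun := by
    rw [continuous_iff]
    intro σ
    refine continuous_of_support_subset (hf _ σ.2) (fun x => Finsupp.mapDomain_support.trans
      (Finset.image_subset_image (support_ofFace_subset K σ x))) fun w => ?_
    -- Summing over σ rather than over the support makes the index set independent of x.
    have h (x : stdSimplex ℝ (σ : Finset V)) : (ofFace K σ x).coords.mapDomain f w =
        ∑ v ∈ (σ : Finset V), if f v = w then (ofFace K σ x).coords v else 0 := by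
      rw [Finsupp.mapDomain, Finsupp.sum_of_support_subset _ (support_ofFace_subset K σ x) _
        (fun _ _ => Finsupp.single_zero _), Finsupp.finsetSum_apply]
      simp only [Finsupp.single_apply]
    refine Continuous.congr ?_ fun x => (h x).symm
    refine continuous_finsetSum _ fun v _ => ?_
    split_ifs
    · exact (continuous_coord K v).comp (continuous_ofFace K σ)
    · exact continuous_const

open Classical in
lemma support_map_subset {W : Type u} {K : PreAbstractSimplicialComplex V}
    {L : PreAbstractSimplicialComplex W} (f : V → W) (hf : ∀ σ ∈ K.faces, σ.image f ∈ L.faces)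
    (t : K.Realization) : (map f hf t).coords.support ⊆ t.coords.support.image f :=
  Finsupp.mapDomain_support

end Realization

/-! ### Pulling back complexes along maps of vertices -/

variable {V W : Type u}

open Classical in
/-- The complex on `V` of all finite nonempty sets of vertices whose image under `p : V → W` is a
face of `L`. -/
def comap (p : V → W) (L : PreAbstractSimplicialComplex W) : PreAbstractSimplicialComplex V where
  faces := {σ | σ.image p ∈ L.faces}
  isRelLowerSet_faces _ hσ :=
    ⟨Finset.image_nonempty.1 (L.isRelLowerSet_faces hσ).1, fun _ hτσ hτ =>
      (L.isRelLowerSet_faces hσ).2 (Finset.image_subset_image hτσ) (hτ.image p)⟩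

lemma mem_comap [DecidableEq W] {p : V → W} {L : PreAbstractSimplicialComplex W} {σ : Finset V} :
    σ ∈ (comap p L).faces ↔ σ.image p ∈ L.faces := by
  rw [comap, Set.mem_ofPred_eq]
  convert Iff.rfl

/-- Pulling back complexes along `p` as a functor. -/
def comapFunctor (p : V → W) : PreAbstractSimplicialComplex W ⥤ PreAbstractSimplicialComplex V :=
  Monotone.functor (f := comap p) fun _ _ h _ hσ => h hσ

/-- The projection `|p⁻¹ L| → |L|`. -/
def comapProj (p : V → W) (L : PreAbstractSimplicialComplex W) :
    C((comap p L).Realization, L.Realization) :=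
  Realization.map p fun _ hσ => hσ

lemma image_image_of_rightInverse [DecidableEq V] [DecidableEq W] {p : V → W} {s : W → V}
    (hs : Function.RightInverse s p) (τ : Finset W) : (τ.image s).image p = τ := by
  rw [Finset.image_image, hs.comp_eq_id, Finset.image_id]

/-- The projection `|p⁻¹ L| → |L|` is a homotopy equivalence if `p` is surjective. -/
lemma exists_homotopyEquiv_comapProj {p : V → W} (hp : Function.Surjective p)
    (L : PreAbstractSimplicialComplex W) :
    ∃ e : ContinuousMap.HomotopyEquiv (comap p L).Realization L.Realization,
      e.toFun = comapProj p L := by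
  classical
  obtain ⟨s, hs⟩ := hp.hasRightInverse
  have hs' : ∀ τ ∈ L.faces, τ.image s ∈ (comap p L).faces := fun τ hτ => by
    rwa [mem_comap, image_image_of_rightInverse hs]
  let i : C(L.Realization, (comap p L).Realization) := Realization.map s hs'
  refine ⟨⟨comapProj p L, i, ?_, ?_⟩, rfl⟩
  -- Adjoining to σ its retract under section and projection does not change the image under p, so
  -- the union is still a face.
  · refine Realization.homotopic_of_contiguous _ _ fun σ hσ =>
      ⟨σ ∪ (σ.image p).image s, ?_, fun t ht => ⟨?_, ?_⟩⟩
    · rw [mem_comap] at hσ ⊢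
      convert hσ using 1
      ext w
      simp only [Finset.mem_image, Finset.mem_union]
      constructor
      · rintro ⟨v, hv | ⟨_, ⟨v', hv', rfl⟩, rfl⟩, rfl⟩
        · exact ⟨v, hv, rfl⟩
        · exact ⟨v', hv', (hs _).symm⟩
      · rintro ⟨v, hv, rfl⟩
        exact ⟨v, Or.inl hv, rfl⟩
    · refine subset_trans ?_ Finset.subset_union_right
      refine (Realization.support_map_subset s hs' (comapProj p L t)).trans ?_
      exact Finset.image_subset_image
        ((Realization.support_map_subset p _ t).trans (Finset.image_subset_image ht))
    · exact ht.trans Finset.subset_union_left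
  · have : (comapProj p L).comp i = ContinuousMap.id _ := by
      ext t : 1
      refine Realization.ext ?_
      change (t.coords.mapDomain s).mapDomain p = t.coords
      rw [← Finsupp.mapDomain_comp, hs.comp_eq_id, Finsupp.mapDomain_id]
    rw [this]

/-- Pulling back a filtration of complexes along a surjection on vertices does not change its weak
homotopy type. -/
lemma objectwiseEquiv_comap {p : V → W} (hp : Function.Surjective p)
    (F : BiIndex ⥤ PreAbstractSimplicialComplex W) :
    ObjectwiseEquiv ((F ⋙ comapFunctor p) ⋙ realization V) (F ⋙ realization W) :=
  ⟨{ app := fun t => ObjectProperty.homMk (TopCat.ofHom (comapProj p (F.obj t)))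
     -- Only the projections have to be natural; the sections, chosen arbitrarily, do not.
     naturality := fun _ _ _ => rfl },
    fun t => exists_homotopyEquiv_comapProj hp (F.obj t)⟩

end PreAbstractSimplicialComplex

/-! ### Interleavings of filtrations -/

/-- Two filtrations by objects of a partially ordered set are interleaved as soon as each one is
contained in the shift of the other. -/
lemma interleaved_of_le {P : Type*} [PartialOrder P] {δ : ℝ≥0} {F G : BiIndex ⥤ P}
    (hFG : ∀ s t : BiIndex, t.m ≤ s.m - δ → s.r + δ ≤ t.r → F.obj s ≤ G.obj t)
    (hGF : ∀ s t : BiIndex, t.m ≤ s.m - δ → s.r + δ ≤ t.r → G.obj s ≤ F.obj t) :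
    Interleaved δ F G := by
  have hmono : Monotone fun p : InterleavingIndex δ =>
      if p.side = 0 then F.obj p.idx else G.obj p.idx := by
    rintro ⟨s, i⟩ ⟨t, j⟩ h
    rcases Fin.exists_fin_two.1 ⟨i, rfl⟩ with rfl | rfl <;>
    rcases Fin.exists_fin_two.1 ⟨j, rfl⟩ with rfl | rfl <;>
    rcases h with ⟨h, hle⟩ | ⟨h, hm, hr⟩ <;> simp at h
    · exact F.monotone hle
    · exact hFG s t hm hr
    · exact hGF s t hm hr
    · exact G.monotone hle
  exact ⟨hmono.functor,
    CategoryTheory.Functor.ext (fun _ => rfl) (fun _ _ _ => Subsingleton.elim _ _),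
    CategoryTheory.Functor.ext (fun _ => rfl) (fun _ _ _ => Subsingleton.elim _ _)⟩

lemma Interleaved.comp {C D : Type*} [Category C] [Category D] {δ : ℝ≥0} {F G : BiIndex ⥤ C}
    (h : Interleaved δ F G) (R : C ⥤ D) : Interleaved δ (F ⋙ R) (G ⋙ R) := by
  obtain ⟨H, rfl, rfl⟩ := h
  exact ⟨H ⋙ R, rfl, rfl⟩

/-! ### Stability of the measure Dowker bifiltration -/

section Stability

variable {Z : Type u} [MetricSpace Z] [MeasurableSpace Z]

/-- If two families of points are pointwise `δ`-close and `μ` is dominated by `ν` up to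
`δ`-thickening, then the measure Dowker condition for one implies the shifted one for the other. -/
lemma ofReal_le_measure_of_close [BorelSpace Z] {C : Type*} {X Y : Set Z} {p : C → X} {q : C → Y}
    {δ : ℝ≥0} (hpq : ∀ c, dist (p c : Z) (q c) ≤ δ) {μ ν : Measure Z}
    (hμν : ∀ B, MeasurableSet B → μ B ≤ ν (Metric.thickening δ B) + δ) {s t : BiIndex}
    (hm : t.m ≤ s.m - δ) (hr : s.r + δ ≤ t.r) {σ : Finset C}
    (hσ : ENNReal.ofReal s.m ≤ μ {z | ∀ c ∈ σ, dist (p c : Z) z ≤ 2 * s.r}) :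
    ENNReal.ofReal t.m ≤ ν {z | ∀ c ∈ σ, dist (q c : Z) z ≤ 2 * t.r} := by
  have hclosed : IsClosed {z | ∀ c ∈ σ, dist (p c : Z) z ≤ 2 * s.r} := by
    simp only [Set.ofPred_forall]
    exact isClosed_iInter fun c => isClosed_iInter fun _ =>
      isClosed_le (continuous_const.dist continuous_id) continuous_const
  -- Two errors of δ occur, from moving the vertex and from thickening; the radius 2r absorbs both
  -- when r grows by δ.
  have hsub : Metric.thickening δ {z | ∀ c ∈ σ, dist (p c : Z) z ≤ 2 * s.r} ⊆
      {z | ∀ c ∈ σ, dist (q c : Z) z ≤ 2 * t.r} := by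
    intro z hz c hc
    obtain ⟨a, ha, hza⟩ := Metric.mem_thickening_iff.1 hz
    have h₁ := ha c hc
    have h₂ := hpq c
    have h₃ := dist_triangle4 (q c : Z) (p c) a z
    rw [dist_comm (q c : Z) (p c), dist_comm a z] at h₃
    change dist (q c : Z) z ≤ 2 * t.r
    linarith
  have h := hσ.trans (hμν _ hclosed.measurableSet)
  -- Positivity of the target mass rules out truncation in `ENNReal.ofReal`. The finite δ then
  -- cancels even when the measures are infinite.
  have hle : ENNReal.ofReal t.m + δ ≤ ENNReal.ofReal s.m := by
    rw [← ENNReal.ofReal_coe_nnreal, ← ENNReal.ofReal_add t.m_pos.le δ.coe_nonneg]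
    exact ENNReal.ofReal_le_ofReal (by linarith)
  exact ((ENNReal.add_le_add_iff_right ENNReal.coe_ne_top).1 (hle.trans h)).trans
    (measure_mono hsub)

open PreAbstractSimplicialComplex in
-- The Dowker condition only sees the set of points p c, so repetitions within a fibre are harmless.
lemma mem_comap_measureDowker {C : Type u} {X : Set Z} {p : C → X} {μ : Measure Z} {t : BiIndex}
    {σ : Finset C} : σ ∈ ((measureDowker X μ ⋙ comapFunctor p).obj t).faces ↔
      σ.Nonempty ∧ ENNReal.ofReal t.m ≤ μ {z | ∀ c ∈ σ, dist (p c : Z) z ≤ 2 * t.r} := by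
  classical
  refine mem_comap.trans (and_congr Finset.image_nonempty ?_)
  simp only [Finset.forall_mem_image]

open PreAbstractSimplicialComplex in
lemma comap_measureDowker_le [BorelSpace Z] {C : Type u} {X Y : Set Z} {p : C → X} {q : C → Y}
    {δ : ℝ≥0} (hpq : ∀ c, dist (p c : Z) (q c) ≤ δ) {μ ν : Measure Z}
    (hμν : ∀ B, MeasurableSet B → μ B ≤ ν (Metric.thickening δ B) + δ) {s t : BiIndex}
    (hm : t.m ≤ s.m - δ) (hr : s.r + δ ≤ t.r) :
    (measureDowker X μ ⋙ comapFunctor p).obj s ≤ (measureDowker Y ν ⋙ comapFunctor q).obj t := by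
  intro σ hσ
  obtain ⟨hne, hσ⟩ := mem_comap_measureDowker.1 hσ
  exact mem_comap_measureDowker.2 ⟨hne, ofReal_le_measure_of_close hpq hμν hm hr hσ⟩

end Stability

end

theorem mainTheorem2 {Z : Type u} [MetricSpace Z] [CompleteSpace Z]
    [TopologicalSpace.SeparableSpace Z] [MeasurableSpace Z] [BorelSpace Z]
    (X₁ X₂ : Set Z) (hX₁ : MeasurableSet X₁) (hX₂ : MeasurableSet X₂) (μ₁ μ₂ : Measure Z) :
    homotopyInterleavingDist (measureDowkerSpace X₁ μ₁) (measureDowkerSpace X₂ μ₂) ≤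
      max (Metric.hausdorffEDist X₁ X₂) (levyProkhorovEDist μ₁ μ₂) := by
  refine le_of_forall_gt_imp_ge_of_dense fun ε hε => ?_
  obtain rfl | hε' := eq_or_ne ε ⊤
  · exact le_top
  lift ε to ℝ≥0 using hε'
  obtain ⟨hH, hP⟩ := max_lt_iff.1 hε
  -- Nearest points need not exist, but the strict bound on the Hausdorff distance supplies a
  -- partner within ε for every point.
  let C : Type u := {c : X₁ × X₂ // edist (c.1 : Z) c.2 < ε}
  let p : C → X₁ := fun c => c.1.1
  let q : C → X₂ := fun c => c.1.2
  have hp : Function.Surjective p := fun x => by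
    obtain ⟨y, hy, hxy⟩ := Metric.exists_edist_lt_of_hausdorffEDist_lt x.2 hH
    exact ⟨⟨(x, ⟨y, hy⟩), hxy⟩, rfl⟩
  have hq : Function.Surjective q := fun y => by
    rw [Metric.hausdorffEDist_comm] at hH
    obtain ⟨x, hx, hxy⟩ := Metric.exists_edist_lt_of_hausdorffEDist_lt y.2 hH
    exact ⟨⟨(⟨x, hx⟩, y), by rwa [edist_comm]⟩, rfl⟩
  have hpq (c : C) : dist (p c : Z) (q c) ≤ ε := by
    have h := c.2.le
    rw [edist_nndist, ENNReal.coe_le_coe] at h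
    exact_mod_cast h
  refine sInf_le ⟨ε, ENNReal.coe_pos.1 (zero_le.trans_lt hε), rfl, _, _,
    .rel _ _ (PreAbstractSimplicialComplex.objectwiseEquiv_comap hp (measureDowker X₁ μ₁)),
    .rel _ _ (PreAbstractSimplicialComplex.objectwiseEquiv_comap hq (measureDowker X₂ μ₂)),
    Interleaved.comp (interleaved_of_le (fun s t hm hr => ?_) fun s t hm hr => ?_) _⟩
  · exact comap_measureDowker_le hpq
      (fun B hB => left_measure_le_of_levyProkhorovEDist_lt hP hB) hm hr
  · exact comap_measureDowker_le (fun c => (dist_comm _ _).trans_le (hpq c))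
      (fun B hB => right_measure_le_of_levyProkhorovEDist_lt hP hB) hm hr
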